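/- Let $d\ge 0$ be an integer, let $G$ be a Borel measure on $(0,+\infty)$ whose tail function $\bar G(u)=G((u,+\infty))$ is finite for every $u>0$, and let $\Phi$ be a Poisson point process on $\mathbb{R}^d\times(0,+\infty)$ with intensity $dx\,G(dm)$, realised as a random locally finite subset of $\mathbb{R}^d\times(0,+\infty)$ on a probability space. For a measurable function $h:\mathbb{R}^d\to[0,+\infty]$ define the extremal shot noise $$M(y)=\sup\{m\,h(y-x)\;;\;(x,m)\in\Phi\}\in[0,+\infty],\qquad y\in\mathbb{R}^d,$$ and put $$\alpha(h,G)=\inf\Big\{u\in(0,+\infty)\;;\;\int_{\mathbb{R}^d}\bar G\big(u/h(x)\big)\,dx<+\infty\Big\},$$ with $\inf\emptyset=+\infty$, $\bar G(u/h(x))=0$ if $h(x)=0$, and $\bar G(u/h(x))=G((0,+\infty))$ if $h(x)=+\infty$. With the Euclidean norm $|\cdot|$, let $$h^+(x)=\sup_{|z|\le 1}h(x+z),\qquad h^-_\varepsilon(x)=\inf_{|z|\le\varepsilon}h(x+z)\quad(\varepsilon>0),$$ $$\alpha^+(h,G)=\alpha(h^+,G),\qquad \alpha^-(h,G)=\lim_{\varepsilon\downarrow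 0}\alpha(h^-_\varepsilon,G).$$ A function $f:\mathbb{R}^d\to[0,+\infty]$ is called universally separable if for every countable dense subset $D$ of $\mathbb{R}^d$ and every $t\in\mathbb{R}^d$ there is a sequence $(t_n)$ of points of $D$ with $t_n\to t$ and $f(t_n)\to f(t)$; it is called USUSC if it is universally separable and upper semicontinuous. If $h$ is USUSC and $\alpha^-(h,G)=\alpha^+(h,G)$, then almost surely the function $y\mapsto M(y)$ is USUSC. -/

import Mathlib

open MeasureTheory ProbabilityTheory Filter Topology
open scoped ENNReal NNReal

noncomputable section

namespace ShotNoise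

/-- The space `ℝ^d` with its Euclidean norm and Lebesgue measure `volume`. -/
abbrev Space (d : ℕ) : Type := EuclideanSpace ℝ (Fin d)

/-- The half-line `(0, +∞)` of weights. -/
abbrev Weight : Type := Set.Ioi (0 : ℝ)

/-- The Poisson law with mean `r ∈ [0, +∞]`, with values in `ℕ ∪ {+∞}`; the law with infinite mean
is the Dirac mass at `+∞`. -/
def poissonLaw (r : ℝ≥0∞) : Measure ℕ∞ :=
  if r = ∞ then Measure.dirac ⊤ else (poissonMeasure r.toNNReal).map (fun n : ℕ => (n : ℕ∞))

/-- The random set `Φ` is a Poisson point process with intensity measure `μ`: it is locally finite,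
the number of points in each Borel set `B` is a random variable with Poisson law of mean `μ B`, and
the numbers of points in finitely many pairwise disjoint Borel sets are independent. -/
structure IsPoissonPointProcess {Ω E : Type*} [MeasurableSpace Ω] [TopologicalSpace E]
    [MeasurableSpace E] (Φ : Ω → Set E) (μ : Measure E) (P : Measure Ω) : Prop where
  locallyFinite : ∀ ω, ∀ K : Set E, IsCompact K → (Φ ω ∩ K).Finite
  measurable_count : ∀ B : Set E, MeasurableSet B → Measurable fun ω => (Φ ω ∩ B).encard
  map_count : ∀ B : Set E, MeasurableSet B →
    P.map (fun ω => (Φ ω ∩ B).encard) = poissonLaw (μ B)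
  indep_count : ∀ (n : ℕ) (B : Fin n → Set E), (∀ i, MeasurableSet (B i)) →
    Pairwise (fun i j => Disjoint (B i) (B j)) →
    iIndepFun (fun i ω => (Φ ω ∩ B i).encard) P

/-- The extremal shot noise `M(y) = sup {m h(y - x) ; (x, m) ∈ S}` of the point set `S`
(the supremum over the empty set being `0`). -/
def extremalShotNoise {d : ℕ} (h : Space d → ℝ≥0∞) (S : Set (Space d × Weight)) (y : Space d) :
    ℝ≥0∞ :=
  ⨆ φ ∈ S, ENNReal.ofReal (φ.2 : ℝ) * h (y - φ.1)

/-- The tail function `u ↦ G((u, +∞))` for `u ∈ [0, +∞]`; it is `G((0, +∞))` at `u = 0` and `0` at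
`u = +∞`. -/
def tail (G : Measure Weight) (u : ℝ≥0∞) : ℝ≥0∞ :=
  G {m | u < ENNReal.ofReal (m : ℝ)}

/-- `α(h, G) = inf {u > 0 ; ∫ Ḡ(u / h(x)) dx < +∞}`, which is `+∞` if there is no such `u`.
For `0 < u < +∞` the quotient `u / h(x)` is `+∞` if `h(x) = 0`, and `0` if `h(x) = +∞`. -/
def alpha {d : ℕ} (h : Space d → ℝ≥0∞) (G : Measure Weight) : ℝ≥0∞ :=
  sInf {u : ℝ≥0∞ | 0 < u ∧ u < ∞ ∧ ∫⁻ x, tail G (u / h x) < ∞}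

/-- `h⁺(x) = sup {h(x + z) ; |z| ≤ 1}`. -/
def upperHull {d : ℕ} (h : Space d → ℝ≥0∞) (x : Space d) : ℝ≥0∞ :=
  ⨆ (z : Space d) (_ : ‖z‖ ≤ 1), h (x + z)

/-- `h⁻_ε(x) = inf {h(x + z) ; |z| ≤ ε}`. -/
def lowerHull {d : ℕ} (h : Space d → ℝ≥0∞) (ε : ℝ) (x : Space d) : ℝ≥0∞ :=
  ⨅ (z : Space d) (_ : ‖z‖ ≤ ε), h (x + z)

/-- `α⁺(h, G) = α(h⁺, G)`. -/
def alphaPlus {d : ℕ} (h : Space d → ℝ≥0∞) (G : Measure Weight) : ℝ≥0∞ :=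
  alpha (upperHull h) G

/-- `α⁻(h, G)` is the limit of `α(h⁻_ε, G)` as `ε ↓ 0`; it exists by `tendsto_alphaMinus`. -/
def alphaMinus {d : ℕ} (h : Space d → ℝ≥0∞) (G : Measure Weight) : ℝ≥0∞ :=
  limUnder (𝓝[>] (0 : ℝ)) fun ε => alpha (lowerHull h ε) G

theorem tail_antitone (G : Measure Weight) : Antitone (tail G) := fun _ _ huv =>
  measure_mono fun _ hm => lt_of_le_of_lt huv hm

theorem alpha_mono {d : ℕ} (G : Measure Weight) {h k : Space d → ℝ≥0∞} (hk : h ≤ k) :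
    alpha h G ≤ alpha k G :=
  sInf_le_sInf fun _ hu => ⟨hu.1, hu.2.1, lt_of_le_of_lt
    (lintegral_mono fun x => tail_antitone G (ENNReal.div_le_div_left (hk x) _)) hu.2.2⟩

theorem tendsto_alphaMinus {d : ℕ} (h : Space d → ℝ≥0∞) (G : Measure Weight) :
    Tendsto (fun ε => alpha (lowerHull h ε) G) (𝓝[>] (0 : ℝ)) (𝓝 (alphaMinus h G)) := by
  have hanti : Antitone fun ε : ℝ => alpha (lowerHull h ε) G := fun a b hab =>
    alpha_mono G fun x => le_iInf₂ fun z hz => iInf₂_le z (hz.trans hab)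
  exact tendsto_nhds_limUnder ⟨_, hanti.tendsto_nhdsGT 0⟩

/-- `f` is `D`-separable: each `f(t)` is the limit of `f` along a sequence of points of `D`
that converges to `t`. -/
def IsSeparableFor {E : Type*} [TopologicalSpace E] (D : Set E) (f : E → ℝ≥0∞) : Prop :=
  ∀ t : E, ∃ s : ℕ → E, (∀ n, s n ∈ D) ∧ Tendsto s atTop (𝓝 t) ∧
    Tendsto (fun n => f (s n)) atTop (𝓝 (f t))

/-- `f` is universally separable: it is `D`-separable for every countable dense set `D`. -/
def UniversallySeparable {E : Type*} [TopologicalSpace E] (f : E → ℝ≥0∞) : Prop :=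
  ∀ D : Set E, D.Countable → Dense D → IsSeparableFor D f

/-- `f` is universally separable and upper semicontinuous. -/
def USUSC {E : Type*} [TopologicalSpace E] (f : E → ℝ≥0∞) : Prop :=
  UniversallySeparable f ∧ UpperSemicontinuous f

end ShotNoise

end

namespace ShotNoise

open MeasureTheory ProbabilityTheory Filter Topology
open scoped ENNReal NNReal

/-! Let `a` be the common value of `alphaMinus` and `alphaPlus`. For `u < a` some `lowerHull h ε`
has infinite integral, so almost surely a shot exceeds `u` at every point, and the noise is at least
`a` everywhere. For `u > a` the integral for `upperHull h` is finite, so almost surely only finitely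
many shots exceed `u` somewhere on a given unit ball. `ae_hasFiniteExceedances` records both facts;
the rest is deterministic. Above `a` the noise is locally governed by finitely many upper
semicontinuous shots. Where it equals `a`, any approximating sequence works; where it is larger, one
shot attains it and the separability of `h` supplies the sequence. -/

theorem upperSemicontinuous_shot {d : ℕ} {h : Space d → ℝ≥0∞} (hh : UpperSemicontinuous h)
    (φ : Space d × Weight) :
    UpperSemicontinuous fun y => ENNReal.ofReal (φ.2 : ℝ) * h (y - φ.1) := by
  have h1 : UpperSemicontinuous fun y => h (y - φ.1) :=
    hh.comp (continuous_id.sub continuous_const)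
  exact Continuous.comp_upperSemicontinuous
    (ENNReal.continuous_const_mul ENNReal.ofReal_ne_top) h1 fun a b hab => by gcongr

theorem le_extremalShotNoise {d : ℕ} (h : Space d → ℝ≥0∞) {S : Set (Space d × Weight)}
    {φ : Space d × Weight} (hφ : φ ∈ S) (y : Space d) :
    ENNReal.ofReal (φ.2 : ℝ) * h (y - φ.1) ≤ extremalShotNoise h S y :=
  le_iSup₂ (f := fun (φ : Space d × Weight) (_ : φ ∈ S) =>
    ENNReal.ofReal (φ.2 : ℝ) * h (y - φ.1)) φ hφ

/-- The level `a` bounds the shot noise of `S` from below, and for every `c > a` only finitely many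
shots exceed some level below `c` near a given point. -/
structure HasFiniteExceedances {d : ℕ} (h : Space d → ℝ≥0∞) (S : Set (Space d × Weight))
    (a : ℝ≥0∞) : Prop where
  le_noise : ∀ y, a ≤ extremalShotNoise h S y
  finite_exceed : ∀ c, a < c → ∀ t, ∃ u < c, ∃ U ∈ 𝓝 t,
    {φ ∈ S | ∃ y ∈ U, u < ENNReal.ofReal (φ.2 : ℝ) * h (y - φ.1)}.Finite

theorem HasFiniteExceedances.upperSemicontinuous {d : ℕ} {h : Space d → ℝ≥0∞}
    {S : Set (Space d × Weight)} {a : ℝ≥0∞} (H : HasFiniteExceedances h S a)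
    (hh : UpperSemicontinuous h) : UpperSemicontinuous (extremalShotNoise h S) := by
  intro y c hc
  obtain ⟨u, huc, U, hU, hF⟩ := H.finite_exceed c ((H.le_noise y).trans_lt hc) y
  -- The supremum of infinitely many terms below `c'` is only `≤ c'`, so room below `c` is needed.
  obtain ⟨c', hc', hc'c⟩ := exists_between (max_lt hc huc)
  have hev : ∀ᶠ y' in 𝓝 y,
      ∀ φ ∈ {φ ∈ S | ∃ y ∈ U, u < ENNReal.ofReal (φ.2 : ℝ) * h (y - φ.1)},
        ENNReal.ofReal (φ.2 : ℝ) * h (y' - φ.1) < c' :=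
    (eventually_all_finite hF).2 fun φ hφ => upperSemicontinuous_shot hh φ y c'
      ((le_extremalShotNoise h hφ.1 y).trans_lt ((le_max_left _ _).trans_lt hc'))
  filter_upwards [hev, hU] with y' hy' hyU
  refine lt_of_le_of_lt (iSup₂_le fun φ hφ => ?_) hc'c
  by_cases hlt : u < ENNReal.ofReal (φ.2 : ℝ) * h (y' - φ.1)
  · exact (hy' φ ⟨hφ, y', hyU, hlt⟩).le
  · exact (not_lt.1 hlt).trans ((le_max_right _ _).trans hc'.le)

theorem HasFiniteExceedances.exists_eq {d : ℕ} {h : Space d → ℝ≥0∞}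
    {S : Set (Space d × Weight)} {a : ℝ≥0∞} (H : HasFiniteExceedances h S a) {t : Space d}
    (ht : a < extremalShotNoise h S t) :
    ∃ φ ∈ S, ENNReal.ofReal (φ.2 : ℝ) * h (t - φ.1) = extremalShotNoise h S t := by
  obtain ⟨u, hu, U, hU, hF⟩ := H.finite_exceed _ ht t
  obtain ⟨φ₀, hφ₀, hlt₀⟩ : ∃ φ ∈ S, u < ENNReal.ofReal (φ.2 : ℝ) * h (t - φ.1) := by
    simpa only [extremalShotNoise, lt_iSup_iff, exists_prop] using hu
  obtain ⟨φ₁, hφ₁, hmax⟩ := Set.exists_max_image _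
    (fun φ : Space d × Weight => ENNReal.ofReal (φ.2 : ℝ) * h (t - φ.1)) hF
    ⟨φ₀, hφ₀, t, mem_of_mem_nhds hU, hlt₀⟩
  refine ⟨φ₁, hφ₁.1, (le_extremalShotNoise h hφ₁.1 t).antisymm (iSup₂_le fun φ hφ => ?_)⟩
  by_cases hlt : u < ENNReal.ofReal (φ.2 : ℝ) * h (t - φ.1)
  · exact hmax φ ⟨hφ, t, mem_of_mem_nhds hU, hlt⟩
  · exact (not_lt.1 hlt).trans
      (hlt₀.le.trans (hmax φ₀ ⟨hφ₀, t, mem_of_mem_nhds hU, hlt₀⟩))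

theorem tendsto_of_upperSemicontinuous {E : Type*} [TopologicalSpace E] {f : E → ℝ≥0∞}
    (hf : UpperSemicontinuous f) {s : ℕ → E} {t : E} (hs : Tendsto s atTop (𝓝 t))
    {g : ℕ → ℝ≥0∞} (hg : Tendsto g atTop (𝓝 (f t))) (hgf : ∀ n, g n ≤ f (s n)) :
    Tendsto (fun n => f (s n)) atTop (𝓝 (f t)) := by
  refine tendsto_order.2 ⟨fun b hb => ?_, fun b hb => hs.eventually (hf t b hb)⟩
  filter_upwards [hg.eventually (lt_mem_nhds hb)] with n hn using hn.trans_le (hgf n)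

theorem HasFiniteExceedances.universallySeparable {d : ℕ} {h : Space d → ℝ≥0∞}
    {S : Set (Space d × Weight)} {a : ℝ≥0∞} (H : HasFiniteExceedances h S a) (hh : USUSC h) :
    UniversallySeparable (extremalShotNoise h S) := by
  intro D hDc hDd t
  have husc := H.upperSemicontinuous hh.2
  rcases (H.le_noise t).eq_or_lt with ht | ht
  · obtain ⟨s, hsD, hs⟩ := mem_closure_iff_seq_limit.1 (hDd t)
    exact ⟨s, hsD, hs, tendsto_of_upperSemicontinuous husc hs
      (ht ▸ tendsto_const_nhds) fun n => H.le_noise (s n)⟩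
  · obtain ⟨φ, hφ, hEq⟩ := H.exists_eq ht
    -- Separability of `h` is applied along the translate of `D` by the attaining point, then
    -- shifted back.
    have hdense : Dense ((Homeomorph.subRight φ.1) '' D) :=
      (Homeomorph.subRight φ.1).surjective.denseRange.dense_image
        (Homeomorph.subRight φ.1).continuous hDd
    obtain ⟨s, hsD, hs, hhs⟩ := hh.1 _ (hDc.image _) hdense (t - φ.1)
    have hs' : Tendsto (fun n => s n + φ.1) atTop (𝓝 t) := by
      simpa using hs.add_const φ.1
    refine ⟨fun n => s n + φ.1, fun n => ?_, hs', ?_⟩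
    · obtain ⟨x, hx, hxs⟩ := hsD n
      have hadd : s n + φ.1 = x := by rw [← hxs]; simp
      exact (congrArg (· ∈ D) hadd).mpr hx
    · refine tendsto_of_upperSemicontinuous husc hs'
        (g := fun n => ENNReal.ofReal (φ.2 : ℝ) * h (s n)) ?_ fun n => ?_
      · rw [← hEq]
        exact ENNReal.Tendsto.const_mul hhs (Or.inr ENNReal.ofReal_ne_top)
      · simpa using le_extremalShotNoise h hφ (s n + φ.1)

theorem upperSemicontinuous_lowerHull {d : ℕ} {h : Space d → ℝ≥0∞} (hh : UpperSemicontinuous h)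
    (ε : ℝ) : UpperSemicontinuous (lowerHull h ε) :=
  upperSemicontinuous_iInf fun _ => upperSemicontinuous_iInf fun _ =>
    hh.comp (continuous_id.add continuous_const)

/-- Compactness of the closed unit ball makes the bound on `h` uniform in `z`. -/
theorem upperSemicontinuous_upperHull {d : ℕ} {h : Space d → ℝ≥0∞} (hh : UpperSemicontinuous h) :
    UpperSemicontinuous (upperHull h) := by
  intro x c hc
  obtain ⟨c', hc', hc'c⟩ := exists_between hc
  have hopen : IsOpen {p : Space d × Space d | h (p.1 + p.2) < c'} :=
    (hh.comp (continuous_fst.add continuous_snd)).isOpen_preimage c'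
  have hev : ∀ᶠ x' in 𝓝 x, ∀ z ∈ Metric.closedBall (0 : Space d) 1, h (x' + z) < c' := by
    refine (isCompact_closedBall (0 : Space d) 1).eventually_forall_of_forall_eventually
      fun z hz => hopen.mem_nhds (lt_of_le_of_lt ?_ hc')
    exact le_iSup₂ (f := fun (z : Space d) (_ : ‖z‖ ≤ 1) => h (x + z)) z (by simpa using hz)
  filter_upwards [hev] with x' hx'
  exact (iSup₂_le fun z hz => (hx' z (by simpa using hz)).le).trans_lt hc'c

theorem sigmaFinite_of_tail_lt_top {G : Measure Weight}
    (hG : ∀ u : ℝ, 0 < u → tail G (ENNReal.ofReal u) < ∞) : SigmaFinite G := by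
  refine ⟨⟨⟨fun n => {m | ENNReal.ofReal (1 / ((n : ℝ) + 1)) < ENNReal.ofReal (m : ℝ)},
    fun _ => trivial, fun n => hG _ (by positivity), ?_⟩⟩⟩
  refine Set.eq_univ_of_forall fun m => Set.mem_iUnion.2 ?_
  obtain ⟨n, hn⟩ := exists_nat_one_div_lt (show (0 : ℝ) < m from m.2)
  exact ⟨n, (ENNReal.ofReal_lt_ofReal_iff m.2).2 hn⟩

/-- The marked points whose shot of shape `k` exceeds the level `u` at `y`. -/
def exceedance {d : ℕ} (k : Space d → ℝ≥0∞) (u : ℝ≥0∞) (y : Space d) :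
    Set (Space d × Weight) :=
  {φ | u < ENNReal.ofReal (φ.2 : ℝ) * k (y - φ.1)}

theorem measurableSet_exceedance {d : ℕ} {k : Space d → ℝ≥0∞} (hk : Measurable k) (u : ℝ≥0∞)
    (y : Space d) : MeasurableSet (exceedance k u y) :=
  measurableSet_lt measurable_const
    ((ENNReal.measurable_ofReal.comp (measurable_subtype_coe.comp measurable_snd)).mul
      (hk.comp (measurable_const.sub measurable_fst)))

theorem div_lt_ofReal_iff {u : ℝ≥0∞} (hu0 : u ≠ 0) (hu : u ≠ ∞) (c : ℝ≥0∞) (m : Weight) :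
    u / c < ENNReal.ofReal (m : ℝ) ↔ u < ENNReal.ofReal (m : ℝ) * c :=
  ENNReal.div_lt_iff (Or.inr hu0) (Or.inr hu)

/-- Fubini and the reflection `x ↦ y - x`: the mean number of exceedances does not depend on `y`. -/
theorem measure_exceedance {d : ℕ} {k : Space d → ℝ≥0∞} (hk : Measurable k) (G : Measure Weight)
    [SigmaFinite G] {u : ℝ≥0∞} (hu0 : u ≠ 0) (hu : u ≠ ∞) (y : Space d) :
    (volume : Measure (Space d)).prod G (exceedance k u y) = ∫⁻ x, tail G (u / k x) := by
  rw [Measure.prod_apply (measurableSet_exceedance hk u y),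
    ← lintegral_sub_left_eq_self (fun x => tail G (u / k x)) y]
  refine lintegral_congr fun x => ?_
  simp only [tail, exceedance, div_lt_ofReal_iff hu0 hu]
  rfl

section Poisson

variable {Ω E : Type*} [MeasurableSpace Ω] [TopologicalSpace E] [MeasurableSpace E]
  {Φ : Ω → Set E} {μ : Measure E} {P : Measure Ω}

theorem IsPoissonPointProcess.ae_finite (hΦ : IsPoissonPointProcess Φ μ P) {B : Set E}
    (hB : MeasurableSet B) (hμ : μ B ≠ ∞) : ∀ᵐ ω ∂P, (Φ ω ∩ B).Finite := by
  have hae : ∀ᵐ n ∂(P.map fun ω => (Φ ω ∩ B).encard), n ≠ ⊤ := by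
    rw [hΦ.map_count B hB, poissonLaw, if_neg hμ]
    refine (ae_map_iff measurable_from_top.aemeasurable
      (measurableSet_singleton (⊤ : ℕ∞)).compl).2 ?_
    exact Eventually.of_forall fun n => ENat.natCast_ne_top n
  filter_upwards [ae_of_ae_map (hΦ.measurable_count B hB).aemeasurable hae] with ω hω
  exact Set.encard_ne_top_iff.1 hω

theorem IsPoissonPointProcess.ae_infinite (hΦ : IsPoissonPointProcess Φ μ P) {B : Set E}
    (hB : MeasurableSet B) (hμ : μ B = ∞) : ∀ᵐ ω ∂P, (Φ ω ∩ B).Infinite := by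
  have hae : ∀ᵐ n ∂(P.map fun ω => (Φ ω ∩ B).encard), n = ⊤ := by
    rw [hΦ.map_count B hB, poissonLaw, if_pos hμ, ae_dirac_eq]
    exact rfl
  filter_upwards [ae_of_ae_map (hΦ.measurable_count B hB).aemeasurable hae] with ω hω
  exact Set.encard_eq_top_iff.1 hω

end Poisson

section ExtremalShotNoise

variable {Ω : Type*} [MeasurableSpace Ω] {P : Measure Ω} {d : ℕ} {G : Measure Weight}
  [SigmaFinite G] {Φ : Ω → Set (Space d × Weight)} {h : Space d → ℝ≥0∞}

theorem ae_le_extremalShotNoise_of_lt_alphaMinus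
    (hΦ : IsPoissonPointProcess Φ ((volume : Measure (Space d)).prod G) P)
    (hh : UpperSemicontinuous h) {u : ℝ≥0∞} (hu : u < alphaMinus h G) :
    ∀ᵐ ω ∂P, ∀ y, u ≤ extremalShotNoise h (Φ ω) y := by
  rcases eq_or_ne u 0 with rfl | hu0
  · exact Eventually.of_forall fun _ _ => zero_le
  obtain ⟨ε, hεα, hε⟩ := (((tendsto_alphaMinus h G).eventually (lt_mem_nhds hu)).and
    self_mem_nhdsWithin).exists
  have hε : 0 < ε := hε
  have hmeas := (upperSemicontinuous_lowerHull hh ε).measurable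
  have hint : ∫⁻ x, tail G (u / lowerHull h ε x) = ∞ := by
    by_contra hne
    exact hεα.not_ge (sInf_le ⟨pos_iff_ne_zero.2 hu0, hu.trans_le le_top, lt_top_iff_ne_top.2 hne⟩)
  -- Passing to `lowerHull` leaves countably many centres to treat: a shot exceeding `u` at a centre
  -- does so for `h` on the whole `ε`-ball around it.
  have hae : ∀ᵐ ω ∂P, ∀ n : ℕ,
      (Φ ω ∩ exceedance (lowerHull h ε) u (TopologicalSpace.denseSeq (Space d) n)).Infinite :=
    ae_all_iff.2 fun n => hΦ.ae_infinite (measurableSet_exceedance hmeas u _)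
      ((measure_exceedance hmeas G hu0 hu.ne_top _).trans hint)
  filter_upwards [hae] with ω hω y
  obtain ⟨n, hn⟩ := (TopologicalSpace.denseRange_denseSeq (Space d)).exists_dist_lt y hε
  obtain ⟨φ, hφ, hex⟩ := (hω n).nonempty
  refine (le_of_lt hex).trans (le_trans ?_ (le_extremalShotNoise h hφ y))
  gcongr
  have hle := iInf₂_le (f := fun (z : Space d) (_ : ‖z‖ ≤ ε) =>
    h (TopologicalSpace.denseSeq (Space d) n - φ.1 + z))
    (y - TopologicalSpace.denseSeq (Space d) n) (by rw [← dist_eq_norm]; exact hn.le)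
  have heq : TopologicalSpace.denseSeq (Space d) n - φ.1 +
    (y - TopologicalSpace.denseSeq (Space d) n) = y - φ.1 := by abel
  rw [heq] at hle
  exact hle

theorem ae_alphaMinus_le_extremalShotNoise
    (hΦ : IsPoissonPointProcess Φ ((volume : Measure (Space d)).prod G) P)
    (hh : UpperSemicontinuous h) :
    ∀ᵐ ω ∂P, ∀ y, alphaMinus h G ≤ extremalShotNoise h (Φ ω) y := by
  have hae : ∀ᵐ ω ∂P, ∀ q : ℚ, (Real.toNNReal q : ℝ≥0∞) < alphaMinus h G →
      ∀ y, (Real.toNNReal q : ℝ≥0∞) ≤ extremalShotNoise h (Φ ω) y := by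
    refine ae_all_iff.2 fun q => ?_
    by_cases hq : (Real.toNNReal q : ℝ≥0∞) < alphaMinus h G
    · filter_upwards [ae_le_extremalShotNoise_of_lt_alphaMinus hΦ hh hq] with ω hω _ using hω
    · exact Eventually.of_forall fun _ hq' => absurd hq' hq
  filter_upwards [hae] with ω hω y
  refine le_of_forall_lt fun b hb => ?_
  obtain ⟨q, -, hbq, hq⟩ := ENNReal.lt_iff_exists_rat_btwn.1 hb
  exact hbq.trans_le (hω q hq y)

theorem ae_finite_exceedance_of_alphaPlus_lt
    (hΦ : IsPoissonPointProcess Φ ((volume : Measure (Space d)).prod G) P)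
    (hh : UpperSemicontinuous h) {u : ℝ≥0∞} (hu : alphaPlus h G < u) (hutop : u ≠ ∞)
    (y : Space d) : ∀ᵐ ω ∂P, (Φ ω ∩ exceedance (upperHull h) u y).Finite := by
  have hmeas := (upperSemicontinuous_upperHull hh).measurable
  -- The infimum gives finiteness only at some `v < u`; monotonicity of the tail carries it to `u`.
  obtain ⟨v, ⟨hv0, hvtop, hv⟩, hvu⟩ := sInf_lt_iff.1 hu
  refine hΦ.ae_finite (measurableSet_exceedance hmeas u y) ?_
  rw [measure_exceedance hmeas G (hv0.trans hvu).ne' hutop]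
  exact ((lintegral_mono fun x =>
    tail_antitone G (ENNReal.div_le_div_right hvu.le _)).trans_lt hv).ne

theorem ae_hasFiniteExceedances
    (hΦ : IsPoissonPointProcess Φ ((volume : Measure (Space d)).prod G) P)
    (hh : UpperSemicontinuous h) (hα : alphaMinus h G = alphaPlus h G) :
    ∀ᵐ ω ∂P, HasFiniteExceedances h (Φ ω) (alphaPlus h G) := by
  -- Rational levels and dense centres give one null set for all `c` and `t`.
  have hae : ∀ᵐ ω ∂P, ∀ (q : ℚ) (n : ℕ), alphaPlus h G < (Real.toNNReal q : ℝ≥0∞) →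
      (Φ ω ∩ exceedance (upperHull h) (Real.toNNReal q)
        (TopologicalSpace.denseSeq (Space d) n)).Finite := by
    refine ae_all_iff.2 fun q => ae_all_iff.2 fun n => ?_
    by_cases hq : alphaPlus h G < (Real.toNNReal q : ℝ≥0∞)
    · filter_upwards [ae_finite_exceedance_of_alphaPlus_lt hΦ hh hq ENNReal.coe_ne_top
        (TopologicalSpace.denseSeq (Space d) n)] with ω hω _ using hω
    · exact Eventually.of_forall fun _ hq' => absurd hq' hq
  filter_upwards [ae_alphaMinus_le_extremalShotNoise hΦ hh, hae] with ω hlow hfin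
  refine ⟨fun y => hα ▸ hlow y, fun c hc t => ?_⟩
  obtain ⟨q, -, hq, hqc⟩ := ENNReal.lt_iff_exists_rat_btwn.1 hc
  obtain ⟨n, hn⟩ := (TopologicalSpace.denseRange_denseSeq (Space d)).exists_dist_lt t one_pos
  refine ⟨_, hqc, Metric.ball (TopologicalSpace.denseSeq (Space d) n) 1,
    Metric.isOpen_ball.mem_nhds hn, (hfin q n hq).subset ?_⟩
  rintro φ ⟨hφ, y, hy, hlt⟩
  refine ⟨hφ, hlt.trans_le ?_⟩
  gcongr
  have hle := le_iSup₂ (f := fun (z : Space d) (_ : ‖z‖ ≤ 1) =>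
    h (TopologicalSpace.denseSeq (Space d) n - φ.1 + z))
    (y - TopologicalSpace.denseSeq (Space d) n)
    (by rw [← dist_eq_norm]; exact (Metric.mem_ball.1 hy).le)
  have heq : TopologicalSpace.denseSeq (Space d) n - φ.1 +
    (y - TopologicalSpace.denseSeq (Space d) n) = y - φ.1 := by abel
  rw [heq] at hle
  exact hle

end ExtremalShotNoise

end ShotNoise

theorem proposition2p7 {Ω : Type*} [MeasurableSpace Ω] (P : Measure Ω) [IsProbabilityMeasure P]
    (d : ℕ) (G : Measure ShotNoise.Weight)
    (hG : ∀ u : ℝ, 0 < u → ShotNoise.tail G (ENNReal.ofReal u) < ∞)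
    (Φ : Ω → Set (ShotNoise.Space d × ShotNoise.Weight))
    (hΦ : ShotNoise.IsPoissonPointProcess Φ
      ((volume : Measure (ShotNoise.Space d)).prod G) P)
    (h : ShotNoise.Space d → ℝ≥0∞) (hh : ShotNoise.USUSC h)
    (hα : ShotNoise.alphaMinus h G = ShotNoise.alphaPlus h G) :
    ∀ᵐ ω ∂P, ShotNoise.USUSC (ShotNoise.extremalShotNoise h (Φ ω)) := by
  have := ShotNoise.sigmaFinite_of_tail_lt_top hG
  filter_upwards [ShotNoise.ae_hasFiniteExceedances hΦ hh.2 hα] with ω hω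
  exact ⟨hω.universallySeparable hh, hω.upperSemicontinuous hh.2⟩
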